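/- Let $A$ be a Krull domain with field of fractions $K$; that is, $A$ is an integral domain such that the localization $A_P$ is a discrete valuation ring for every prime ideal $P$ of height one, $A=\bigcap_{\operatorname{ht}P=1}A_P$ (the empty intersection in $K$ being $K$), and every nonzero element of $A$ lies in only finitely many primes of height one. Let $\operatorname{Cl}(A)$ be the divisor class group of $A$, i.e. the free abelian group on the height-one primes of $A$ modulo the subgroup of principal divisors $\operatorname{div}(x)=\sum_P \operatorname{ord}_P(x)\,P$, $x\in K\setminus\{0\}$, where $\operatorname{ord}_P$ is the normalized valuation of $A_P$. An overring of $A$ is a subring $B$ of $K$ containing $A$. It is a localization of $A$ if $B=A_S$ for some multiplicatively closed set $S$ of nonzero elements of $A$, and a sublocalization of $A$ if it is the intersection of a family of localizations of $A$. Then $\operatorname{Cl}(A)$ is a torsion group if and only if every sublocalization of $A$ is a localization of $A$. -/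

import Mathlib

open scoped nonZeroDivisors

namespace KrullCl

/-- The overring `A_S` of fractions `a / s` with `s ∈ S`, inside the fraction field `K` of `A`. -/
noncomputable abbrev fractions {A : Type*} [CommRing A] [IsDomain A] (K : Type*) [Field K]
    [Algebra A K] [IsFractionRing A K] (S : Submonoid A) (hS : S ≤ A⁰) : Subalgebra A K :=
  Localization.subalgebra.ofField K S hS

/-- The overring `B` of `A` (inside the fraction field `K`) is a localization of `A`:
`B = A_S` for a multiplicatively closed set `S` of nonzero elements of `A`. -/
def IsLocalizationOf {A : Type*} [CommRing A] [IsDomain A] {K : Type*} [Field K]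
    [Algebra A K] [IsFractionRing A K] (B : Subalgebra A K) : Prop :=
  ∃ (S : Submonoid A) (hS : S ≤ A⁰), B = fractions K S hS

/-- The overring `B` of `A` is a sublocalization of `A`: an intersection (in `K`) of
a family of localizations of `A`. -/
def IsSublocalizationOf {A : Type*} [CommRing A] [IsDomain A] {K : Type*} [Field K]
    [Algebra A K] [IsFractionRing A K] (B : Subalgebra A K) : Prop :=
  ∃ F : Set (Subalgebra A K), (∀ C ∈ F, IsLocalizationOf C) ∧ B = sInf F

/-- The prime ideals of `A` of height one. -/
abbrev HeightOnePrime (A : Type*) [CommRing A] : Type _ :=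
  {P : PrimeSpectrum A // P.asIdeal.height = 1}

/-- The localization `A_P` at a height-one prime, as a subring of the fraction field. -/
noncomputable abbrev localRing {A : Type*} [CommRing A] [IsDomain A] (K : Type*) [Field K]
    [Algebra A K] [IsFractionRing A K] (P : HeightOnePrime A) : Subalgebra A K :=
  fractions K P.1.asIdeal.primeCompl P.1.asIdeal.primeCompl_le_nonZeroDivisors

/-- `A`, with fraction field `K`, is a Krull domain: every `A_P` with `P` of height one is a
discrete valuation ring, `A` is the intersection of these `A_P`, and every nonzero element
of `A` lies in only finitely many primes of height one. -/
class IsKrullDomain (A : Type*) [CommRing A] [IsDomain A] (K : Type*) [Field K]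
    [Algebra A K] [IsFractionRing A K] : Prop where
  dvr : ∀ P : HeightOnePrime A, IsDiscreteValuationRing (localRing K P)
  iInf_eq_bot : (⨅ P : HeightOnePrime A, localRing K P) = ⊥
  finite : ∀ a : A, a ≠ 0 → {P : HeightOnePrime A | a ∈ P.1.asIdeal}.Finite

attribute [instance] IsKrullDomain.dvr

section

variable {A : Type*} [CommRing A] [IsDomain A] (K : Type*) [Field K]
  [Algebra A K] [IsFractionRing A K] [IsKrullDomain A K]

/-- The (multiplicative) valuation of `K` with valuation ring `A_P`. -/
noncomputable def val (P : HeightOnePrime A) : Valuation K (WithZero (Multiplicative ℤ)) :=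
  (IsDiscreteValuationRing.maximalIdeal (localRing K P)).valuation K

/-- The normalized order function `ord_P` on `Kˣ`: a uniformizer of `A_P` has order `1`. -/
noncomputable def ord (P : HeightOnePrime A) (x : Kˣ) : ℤ :=
  -WithZero.log (val K P (x : K))

theorem ord_mul (P : HeightOnePrime A) (x y : Kˣ) :
    ord K P (x * y) = ord K P x + ord K P y := by
  have hx : val K P (x : K) ≠ 0 := (Valuation.ne_zero_iff _).2 x.ne_zero
  have hy : val K P (y : K) ≠ 0 := (Valuation.ne_zero_iff _).2 y.ne_zero
  simp only [ord, Units.val_mul, map_mul]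
  rw [WithZero.log_mul hx hy]
  ring

theorem ord_one (P : HeightOnePrime A) : ord K P 1 = 0 := by
  simp [ord]

theorem val_eq_one (P : HeightOnePrime A) (a : A) (ha : a ∉ P.1.asIdeal) :
    val K P (algebraMap A K a) = 1 := by
  have hu : IsUnit (algebraMap A (localRing K P) a) :=
    IsLocalization.map_units (M := P.1.asIdeal.primeCompl) (localRing K P) ⟨a, ha⟩
  obtain ⟨u, hu⟩ := hu
  have key : ∀ z : localRing K P, val K P (z : K) ≤ 1 := fun z =>
    (IsDiscreteValuationRing.maximalIdeal (localRing K P)).valuation_le_one z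
  have h1 := key u
  have h2 := key (u⁻¹ : (localRing K P)ˣ)
  have h3 : val K P ((u : localRing K P) : K) *
      val K P (((u⁻¹ : (localRing K P)ˣ) : localRing K P) : K) = 1 := by
    rw [← map_mul, ← MulMemClass.coe_mul, Units.mul_inv]
    simp
  have h4 : val K P ((u : localRing K P) : K) = 1 := by
    apply le_antisymm h1
    calc (1 : WithZero (Multiplicative ℤ)) = _ := h3.symm
      _ ≤ val K P ((u : localRing K P) : K) * 1 := by gcongr
      _ = _ := mul_one _
  rw [hu] at h4
  exact h4

theorem ord_support_finite (x : Kˣ) : {P : HeightOnePrime A | ord K P x ≠ 0}.Finite := by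
  obtain ⟨a, b, hb, hx⟩ := IsFractionRing.div_surjective (A := A) (x : K)
  have hb0 : b ≠ 0 := nonZeroDivisors.ne_zero hb
  have ha0 : a ≠ 0 := by
    rintro rfl
    exact x.ne_zero (by rw [← hx]; simp)
  refine ((IsKrullDomain.finite (K := K) a ha0).union
    (IsKrullDomain.finite (K := K) b hb0)).subset ?_
  intro P hP
  by_contra hc
  simp only [Set.mem_union, Set.mem_ofPred_eq, not_or] at hc
  apply hP
  simp [ord, ← hx, map_div₀, val_eq_one K P a hc.1, val_eq_one K P b hc.2]

variable (A) in
/-- The group of divisors of `A`: the free abelian group on the height-one primes. -/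
abbrev Divisor : Type _ := HeightOnePrime A →₀ ℤ

variable (A) in
/-- The divisor homomorphism `x ↦ ∑ ord_P(x) P`, from `Kˣ` to the divisors of `A`. -/
noncomputable def divHom : Additive Kˣ →+ Divisor A where
  toFun x := Finsupp.ofSupportFinite (fun P => ord K P x.toMul) (ord_support_finite K x.toMul)
  map_zero' := by
    ext P
    exact ord_one K P
  map_add' x y := by
    ext P
    exact ord_mul K P x.toMul y.toMul

variable (A) in
/-- The divisor class group of the Krull domain `A`: divisors modulo principal divisors. -/
abbrev DivisorClassGroup : Type _ := Divisor A ⧸ (divHom A K).range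

end

end KrullCl

/-!
Membership of `x ∈ K` in `A` or in a localization `A_S` is read off from the orders `ord_P`.
The basic tool is `exists_mem_forall_div_mem_localRing`: if a multiplicative set `S` meets the
height-one primes of a family that contain a given `a ≠ 0`, then some `s ∈ S` is divisible by
`a` in all the local rings of the family. For the family of all height-one primes this gives
`s / a ∈ A`.

Suppose `Cl(A)` is torsion, and let `B` be an intersection of localizations. Let `Λ` be the set of
height-one `P` with `B ⊆ A_P`, and `T` the set of nonzero elements of `A` outside every `P ∈ Λ`.
Each `t ∈ T` is a unit of `B`, since a localization containing `B` is given by an `S` that meets every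
`P ∉ Λ`, in particular every height-one prime containing `t`. So `A_T ⊆ B`. If `x ∈ B`, then the
pole divisor of `x` is supported off `Λ`, and a positive multiple of it is `div y`; this `y` lies in
`T` and `x y ∈ A`, so `x ∈ A_T`.

Conversely, fix a height-one `P` and let `B = ⋂_{Q ≠ P} A_Q`. Some quotient `b / a` lies in `B` but
not in `A_P` (the tool with `S = A \ P` and the family of all `Q ≠ P`). If `B = A_S`, the
denominator `s ∈ S` of this element is a unit in each `A_Q` with `Q ≠ P` but not in `A_P`, so
`div s = n P` with `n > 0`. Thus the classes of all height-one primes are torsion, and these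
generate `Cl(A)`.
-/

namespace KrullCl

/-- Distinct height-one primes are incomparable. -/
theorem exists_mem_notMem_of_ne {A : Type*} [CommRing A] {P Q : HeightOnePrime A}
    (h : Q ≠ P) : ∃ q ∈ Q.1.asIdeal, q ∉ P.1.asIdeal := by
  by_contra! hle
  have hle' : Q.1.asIdeal ≤ P.1.asIdeal := hle
  have : Q.1.asIdeal.FiniteHeight := ⟨Or.inr (by simp [Q.2])⟩
  exact h (Subtype.ext (PrimeSpectrum.ext
    (Ideal.eq_of_le_of_height_le _ hle' (by rw [P.2, Q.2]))))

section

variable {A : Type*} [CommRing A] [IsDomain A] {K : Type*} [Field K]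
  [Algebra A K] [IsFractionRing A K]

theorem mem_fractions_iff {S : Submonoid A} {hS : S ≤ A⁰} {x : K} :
    x ∈ fractions K S hS ↔ ∃ a s : A, s ∈ S ∧ x = algebraMap A K a * (algebraMap A K s)⁻¹ := by
  change (∃ (a s : A) (_ : s ∈ S), x = algebraMap A K a * (algebraMap A K s)⁻¹) ↔ _
  simp only [exists_prop]

theorem inv_mem_fractions {S : Submonoid A} (hS : S ≤ A⁰) {s : A} (hs : s ∈ S) :
    (algebraMap A K s)⁻¹ ∈ fractions K S hS :=
  mem_fractions_iff.2 ⟨1, s, hs, by simp⟩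

variable [IsKrullDomain A K]

theorem mem_localRing_iff_val_le_one {P : HeightOnePrime A} {x : K} :
    x ∈ localRing K P ↔ val K P x ≤ 1 := by
  constructor
  · intro hx
    exact (IsDiscreteValuationRing.maximalIdeal (localRing K P)).valuation_le_one ⟨x, hx⟩
  · intro hx
    obtain ⟨a, rfl⟩ := IsDiscreteValuationRing.exists_lift_of_le_one (A := localRing K P) hx
    exact a.2

theorem mem_localRing_iff_ord_nonneg {P : HeightOnePrime A} {x : Kˣ} :
    (x : K) ∈ localRing K P ↔ 0 ≤ ord K P x := by
  have hx : val K P (x : K) ≠ 0 := (Valuation.ne_zero_iff _).2 x.ne_zero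
  rw [mem_localRing_iff_val_le_one, ord, neg_nonneg, ← WithZero.log_one,
    WithZero.log_le_log hx one_ne_zero]

theorem mem_range_algebraMap_iff {x : K} :
    (∃ a : A, algebraMap A K a = x) ↔ ∀ P : HeightOnePrime A, x ∈ localRing K P := by
  rw [← Algebra.mem_iInf, IsKrullDomain.iInf_eq_bot, Algebra.mem_bot, Set.mem_range]

theorem val_lt_one {P : HeightOnePrime A} {a : A} (ha : a ∈ P.1.asIdeal) :
    val K P (algebraMap A K a) < 1 := by
  refine lt_of_le_of_ne (mem_localRing_iff_val_le_one.1 ((localRing K P).algebraMap_mem a)) ?_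
  intro h1
  have ha0 : algebraMap A K a ≠ 0 := by
    intro h0
    simp [h0] at h1
  -- Otherwise the inverse of `a` is in `A_P`, so `a` divides an element outside `P`.
  obtain ⟨b, s, hs, h⟩ := mem_fractions_iff.1 (mem_localRing_iff_val_le_one (P := P).2
    (show val K P (algebraMap A K a)⁻¹ ≤ 1 by rw [map_inv₀, h1, inv_one]))
  have hs0 : algebraMap A K s ≠ 0 :=
    IsFractionRing.to_map_ne_zero_of_mem_nonZeroDivisors
      (P.1.asIdeal.primeCompl_le_nonZeroDivisors hs)
  have hsab : s = a * b := by
    apply IsFractionRing.injective A K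
    rw [map_mul]
    field_simp at h
    linear_combination h
  exact hs (hsab ▸ P.1.asIdeal.mul_mem_right b ha)

theorem mem_iff_ord_pos {P : HeightOnePrime A} {a : A} {x : Kˣ} (hx : algebraMap A K a = x) :
    a ∈ P.1.asIdeal ↔ 0 < ord K P x := by
  constructor
  · intro ha
    have h0 : val K P (x : K) ≠ 0 := (Valuation.ne_zero_iff _).2 x.ne_zero
    rw [ord, neg_pos, ← WithZero.log_one, WithZero.log_lt_log h0 one_ne_zero, ← hx]
    exact val_lt_one ha
  · contrapose!
    intro ha
    simp [ord, ← hx, val_eq_one K P a ha]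

theorem ord_inv (P : HeightOnePrime A) (x : Kˣ) : ord K P x⁻¹ = -ord K P x := by
  have h := ord_mul K P x x⁻¹
  rw [mul_inv_cancel, ord_one] at h
  omega

/-- If the submonoid `S` meets every prime of the family `Q` containing `a`, then some `s ∈ S` is
divisible by `a` in all the local rings of the family. -/
theorem exists_mem_forall_div_mem_localRing (S : Submonoid A) (Q : Set (HeightOnePrime A))
    {a : A} (ha : a ≠ 0) (h : ∀ P ∈ Q, a ∈ P.1.asIdeal → ∃ s ∈ S, s ∈ P.1.asIdeal) :
    ∃ s ∈ S, ∀ P ∈ Q, algebraMap A K s * (algebraMap A K a)⁻¹ ∈ localRing K P := by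
  classical
  have ha0 : algebraMap A K a ≠ 0 := by simpa using ha
  have key (P : HeightOnePrime A) : ∃ s ∈ S, P ∈ Q → a ∈ P.1.asIdeal →
      val K P (algebraMap A K s) ≤ val K P (algebraMap A K a) := by
    by_cases hP : P ∈ Q ∧ a ∈ P.1.asIdeal
    · obtain ⟨s, hs, hsP⟩ := h P hP.1 hP.2
      obtain ⟨n, hn⟩ := exists_pow_lt₀ (val_lt_one (K := K) hsP)
        (Units.mk0 _ ((Valuation.ne_zero_iff (val K P)).2 ha0))
      refine ⟨s ^ n, S.pow_mem hs n, fun _ _ => ?_⟩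
      rw [map_pow, map_pow]
      exact hn.le
    · exact ⟨1, S.one_mem, fun h1 h2 => absurd ⟨h1, h2⟩ hP⟩
  choose c hcS hc using key
  have hfin := IsKrullDomain.finite (K := K) a ha
  refine ⟨∏ P ∈ hfin.toFinset, c P, S.prod_mem fun P _ => hcS P, fun P hPQ => ?_⟩
  rw [mem_localRing_iff_val_le_one, map_mul, map_inv₀, ← div_eq_mul_inv]
  apply div_le_one_of_le₀ _ zero_le
  have hle (b : A) : val K P (algebraMap A K b) ≤ 1 :=
    mem_localRing_iff_val_le_one.1 ((localRing K P).algebraMap_mem b)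
  by_cases haP : a ∈ P.1.asIdeal
  · obtain ⟨r, hr⟩ := Finset.dvd_prod_of_mem c (hfin.mem_toFinset.2 haP)
    rw [hr, map_mul, map_mul]
    exact (mul_le_of_le_one_right' (hle r)).trans (hc P hPQ haP)
  · rw [val_eq_one K P a haP]
    exact hle _

/-- In a Krull domain with torsion class group, some multiple of the pole divisor of `x` is the
divisor of an element of `A`, which therefore serves as a denominator of `x`. -/
theorem exists_denominator (h : IsAddTorsion (DivisorClassGroup A K)) (x : Kˣ) :
    ∃ a y : A, y ≠ 0 ∧ (x : K) = algebraMap A K a * (algebraMap A K y)⁻¹ ∧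
      ∀ P : HeightOnePrime A, (x : K) ∈ localRing K P → y ∉ P.1.asIdeal := by
  let D : Divisor A := (divHom A K (Additive.ofMul x)).mapRange (fun m => max 0 (-m)) (by simp)
  obtain ⟨n, hn, hD⟩ := isOfFinAddOrder_iff_nsmul_eq_zero.1
    (h (QuotientAddGroup.mk D : DivisorClassGroup A K))
  rw [← QuotientAddGroup.mk_nsmul, QuotientAddGroup.eq_zero_iff] at hD
  obtain ⟨y, hy⟩ := hD
  have hord (P : HeightOnePrime A) : ord K P y.toMul = n * max 0 (-ord K P x) := by
    have := DFunLike.congr_fun hy P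
    rw [Finsupp.smul_apply, nsmul_eq_mul] at this
    exact this
  have hn' : (1 : ℤ) ≤ n := by exact_mod_cast hn
  obtain ⟨b, hb⟩ := (mem_range_algebraMap_iff (A := A) (x := (y.toMul : K))).2 fun P => by
    rw [mem_localRing_iff_ord_nonneg, hord]
    positivity
  obtain ⟨a, ha⟩ := (mem_range_algebraMap_iff (A := A)
      (x := ((x * y.toMul : Kˣ) : K))).2 fun P => by
    rw [mem_localRing_iff_ord_nonneg, ord_mul, hord]
    have h1 : max 0 (-ord K P x) ≤ n * max 0 (-ord K P x) :=
      le_mul_of_one_le_left (le_max_left _ _) hn'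
    have h2 := le_max_right 0 (-ord K P x)
    omega
  refine ⟨a, b, ?_, ?_, fun P hP => ?_⟩
  · rintro rfl
    exact y.toMul.ne_zero (by rw [← hb, map_zero])
  · rw [ha, hb, Units.val_mul, mul_inv_cancel_right₀ y.toMul.ne_zero]
  · rw [mem_localRing_iff_ord_nonneg] at hP
    rw [mem_iff_ord_pos hb, hord, max_eq_left (by omega), mul_zero]
    exact lt_irrefl 0

theorem isLocalizationOf_of_isAddTorsion (h : IsAddTorsion (DivisorClassGroup A K))
    {B : Subalgebra A K} (hB : IsSublocalizationOf B) : IsLocalizationOf B := by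
  obtain ⟨F, hF, rfl⟩ := hB
  -- The condition at the zero ideal keeps `0` out of `T` when no height-one prime occurs.
  let T : Submonoid A := A⁰ ⊓
    ⨅ P : {P : HeightOnePrime A // sInf F ≤ localRing K P}, P.1.1.asIdeal.primeCompl
  have hT {t : A} : t ∈ T ↔ t ≠ 0 ∧
      ∀ P : HeightOnePrime A, sInf F ≤ localRing K P → t ∉ P.1.asIdeal := by
    simp only [T, Submonoid.mem_inf, mem_nonZeroDivisors_iff_ne_zero, Submonoid.mem_iInf,
      Subtype.forall, Ideal.mem_primeCompl_iff]
  refine ⟨T, inf_le_left, le_antisymm (fun x hx => ?_) (fun x hx => ?_)⟩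
  · rcases eq_or_ne x 0 with rfl | hx0
    · exact zero_mem _
    obtain ⟨a, y, hy0, hxy, hy⟩ := exists_denominator h (Units.mk0 x hx0)
    exact mem_fractions_iff.2 ⟨a, y, hT.2 ⟨hy0, fun P hP => hy P (hP hx)⟩, hxy⟩
  · obtain ⟨a, t, ht, rfl⟩ := mem_fractions_iff.1 hx
    refine mul_mem (Subalgebra.algebraMap_mem _ a) (Algebra.mem_sInf.2 fun C hC => ?_)
    obtain ⟨ht0, htP⟩ := hT.1 ht
    obtain ⟨S, hS, rfl⟩ := hF C hC
    obtain ⟨s, hs, hst⟩ := exists_mem_forall_div_mem_localRing (K := K) S Set.univ ht0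
      fun P _ htmem => by
        by_contra! hdisj
        refine htP P (fun z hz => ?_) htmem
        obtain ⟨b, s, hs, rfl⟩ := mem_fractions_iff.1 (Algebra.mem_sInf.1 hz _ hC)
        exact mem_fractions_iff.2 ⟨b, s, hdisj s hs, rfl⟩
    obtain ⟨b, hb⟩ := mem_range_algebraMap_iff.2 fun P => hst P (Set.mem_univ P)
    have hs0 : algebraMap A K s ≠ 0 := IsFractionRing.to_map_ne_zero_of_mem_nonZeroDivisors (hS hs)
    refine mem_fractions_iff.2 ⟨b, s, hs, ?_⟩
    rw [hb]
    field_simp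

/-- If `⋂_{Q ≠ P} A_Q` is a localization of `A`, then some positive multiple of `P` is a principal
divisor. -/
theorem exists_divHom_eq_single (P : HeightOnePrime A)
    (h : IsLocalizationOf (sInf {C : Subalgebra A K | ∃ Q ≠ P, C = localRing K Q})) :
    ∃ n : ℤ, 0 < n ∧ ∃ y, divHom A K y = Finsupp.single P n := by
  obtain ⟨S, hS, hB⟩ := h
  have hmem {x : K} : x ∈ fractions K S hS ↔ ∀ Q ≠ P, x ∈ localRing K Q := by
    rw [← hB, Algebra.mem_sInf]
    constructor
    · exact fun hx Q hQ => hx _ ⟨Q, hQ, rfl⟩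
    · rintro hx _ ⟨Q, hQ, rfl⟩
      exact hx Q hQ
  obtain ⟨a, haP, ha0⟩ := Submodule.exists_mem_ne_zero_of_ne_bot
    (Ideal.ne_bot_of_height_eq_one P.2)
  obtain ⟨b, hbP, hb⟩ := exists_mem_forall_div_mem_localRing (K := K) P.1.asIdeal.primeCompl
    {Q | Q ≠ P} ha0 fun Q hQ _ => by
      obtain ⟨q, hq, hqP⟩ := exists_mem_notMem_of_ne hQ
      exact ⟨q, hqP, hq⟩
  obtain ⟨c, s, hs, hcs⟩ := mem_fractions_iff.1 (hmem.2 hb)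
  have hs0 : algebraMap A K s ≠ 0 := IsFractionRing.to_map_ne_zero_of_mem_nonZeroDivisors (hS hs)
  have ha0' : algebraMap A K a ≠ 0 := by simpa using ha0
  have hsP : s ∈ P.1.asIdeal := by
    by_contra hsP
    have hbs : b * s = a * c := by
      apply IsFractionRing.injective A K
      rw [map_mul, map_mul]
      field_simp at hcs
      linear_combination hcs
    exact P.1.asIdeal.primeCompl.mul_mem hbP hsP (hbs ▸ P.1.asIdeal.mul_mem_right c haP)
  let y : Kˣ := Units.mk0 _ hs0
  refine ⟨ord K P y, (mem_iff_ord_pos rfl).1 hsP, Additive.ofMul y, Finsupp.ext fun Q => ?_⟩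
  change ord K Q y = _
  rcases eq_or_ne Q P with rfl | hQ
  · simp
  · rw [Finsupp.single_eq_of_ne hQ]
    have h1 : 0 ≤ ord K Q y :=
      mem_localRing_iff_ord_nonneg.1 ((localRing K Q).algebraMap_mem s)
    have h2 : 0 ≤ ord K Q y⁻¹ := by
      rw [← mem_localRing_iff_ord_nonneg, Units.val_inv_eq_inv_val]
      exact hmem.1 (inv_mem_fractions hS hs) Q hQ
    rw [ord_inv] at h2
    omega

theorem isAddTorsion_of_forall_isLocalizationOf
    (h : ∀ B : Subalgebra A K, IsSublocalizationOf B → IsLocalizationOf B) :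
    IsAddTorsion (DivisorClassGroup A K) := by
  intro g
  obtain ⟨D, rfl⟩ := QuotientAddGroup.mk_surjective g
  induction D using Finsupp.induction_linear with
  | zero => exact IsOfFinAddOrder.zero
  | add D E hD hE => exact hD.add hE
  | single P m =>
    obtain ⟨n, hn, y, hy⟩ := exists_divHom_eq_single P (h _ ⟨_, by
      rintro _ ⟨Q, -, rfl⟩
      exact ⟨_, _, rfl⟩, rfl⟩)
    refine isOfFinAddOrder_iff_nsmul_eq_zero.2 ⟨n.toNat, by omega, ?_⟩
    rw [← QuotientAddGroup.mk_nsmul, QuotientAddGroup.eq_zero_iff]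
    refine ⟨m • y, ?_⟩
    rw [map_zsmul, hy, ← natCast_zsmul, Int.toNat_of_nonneg hn.le, Finsupp.smul_single,
      Finsupp.smul_single, smul_eq_mul, smul_eq_mul, mul_comm]

end

end KrullCl

theorem corollary2p8 {A : Type*} [CommRing A] [IsDomain A] {K : Type*} [Field K]
    [Algebra A K] [IsFractionRing A K] [KrullCl.IsKrullDomain A K] :
    IsAddTorsion (KrullCl.DivisorClassGroup A K) ↔
      ∀ B : Subalgebra A K, KrullCl.IsSublocalizationOf B → KrullCl.IsLocalizationOf B :=
  ⟨fun h _ hB => KrullCl.isLocalizationOf_of_isAddTorsion h hB,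
    KrullCl.isAddTorsion_of_forall_isLocalizationOf⟩
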